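/- Let $n$ be an integer with $3\nmid n$ or $n\equiv 12\pmod{27}$, let $\rho_n\in\mathbb C$ be any root of Shanks' cubic polynomial $f_n(X)=X^3-nX^2-(n+3)X-1$, and let $L_n=\mathbb Q(\rho_n)$ be the simplest cubic field, which is a cyclic cubic extension of $\mathbb Q$. Let $\sigma$ be the generator of $\mathrm{Gal}(L_n/\mathbb Q)$ with $\sigma(\rho_n)=-1/(1+\rho_n)$, and put $\rho_n'=\sigma(\rho_n)$. Let $\zeta=e^{2\pi i/3}$ and $A_n=n+3(1+\zeta)$, and write $\Delta_n=n^2+3n+9=de^2c^3$ with positive integers $d,e,c$, where $d$ and $e$ are square-free and $\gcd(d,e)=1$. Let $a_0,a_1$ be integers with $ec=a_0^2-a_0a_1+a_1^2$ and $a_0+a_1\zeta\mid A_n$ in $\mathbb Z[\zeta]$. Then there is a unique $\varepsilon\in\{\pm1\}$ with $$\varepsilon\equiv\begin{cases} n(a_0+a_1)\pmod 3, & \text{if } 3\nmid n,\\ a_0\pmod 3, & \text{if } n\equiv 12\pmod{27},\end{cases}$$ the number $m=(\varepsilon ec^2-n(a_0+a_1))/3$ is an integer, and $$\frac{1}{ec^2}(a_0\rho_n+a_1\rho_n'+m)=\frac{1}{ec^2}\bigl(a_1\rho_n^2+(a_0-a_1n-a_1)\rho_n+m-2a_1\bigr)$$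 is a generator of a normal integral basis of $L_n$; that is, its conjugates under $\mathrm{Gal}(L_n/\mathbb Q)$ form a $\mathbb Z$-basis of the ring of integers of $L_n$. -/

import Mathlib

open Polynomial
open scoped NumberField IntermediateField

noncomputable section

/-- Shanks' cubic polynomial `f_n(X) = X³ - nX² - (n+3)X - 1`. -/
def shanksPoly (n : ℤ) : ℤ[X] :=
  X ^ 3 - C n * X ^ 2 - C (n + 3) * X - 1

/-- The primitive cube root of unity `ζ₃ = e^{2πi/3}`. -/
def zeta3 : ℂ := Complex.exp (2 * Real.pi * Complex.I / 3)

/-- The ring `ℤ[ζ₃]`, as a subring of `ℂ`. -/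
abbrev EisensteinRing : Subalgebra ℤ ℂ := Algebra.adjoin ℤ {zeta3}

/-- `ζ₃` as an element of `ℤ[ζ₃]`. -/
def zetaE : EisensteinRing := ⟨zeta3, Algebra.self_mem_adjoin_singleton ℤ zeta3⟩

/-- `α` generates a normal integral basis of `K/ℚ`: the extension `K/ℚ` is finite Galois, and the
family of conjugates `σ(α)`, `σ ∈ Gal(K/ℚ)`, is a `ℤ`-basis of the ring of integers of `K`. -/
def IsNormalIntegralBasisGenerator (K : Type*) [Field K] [Algebra ℚ K] (α : K) : Prop :=
  FiniteDimensional ℚ K ∧ IsGalois ℚ K ∧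
    ∃ b : Module.Basis (K ≃ₐ[ℚ] K) ℤ (𝓞 K), ∀ σ : K ≃ₐ[ℚ] K, ((b σ : 𝓞 K) : K) = σ α

/-- The chosen root `ρ`, as an element of the field `ℚ(ρ)`. -/
abbrev rootGen (ρ : ℂ) : ℚ⟮ρ⟯ := IntermediateField.AdjoinSimple.gen ℚ ρ

end

/-! Let α be the proposed generator and y = 3α - ε, a trace-zero element. With a = a₀ + a₁ζ, A = A_n
and b = b₀ + b₁ζ = A ā³/(e²c³), one has y³ = 3fy + fT, where f = N(b) = de is squarefree and T =
Tr(b) (`resolvent_cube`, `norm_resolvent`). That b lies in ℤ[ζ] follows from the coprimality of A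
and its conjugate (`exists_quotient`); for n ≡ 12 (mod 27) the factors above 3 are removed first.
The sign ε is chosen so that b ≡ ε (mod 3); this gives f ≡ 1 (mod 3) and the congruence modulo 27
that makes α integral.

Spanning is proved without discriminants. For integral x and a conjugate z of y, (xz)³ is f times an
integral element, so f ∣ Tr(xz) because f is squarefree (`dvd_trace_of_cube_eq`). The dual basis of
the conjugates of α under the trace form consists of the conjugates of (y + fε)/(3f). The
coordinates of x are therefore traces, and f ∣ Tr(xz) together with integrality of the Tr(xβ), β =
(z + ε)/3, makes them integers (`isNormalIntegralBasisGenerator_of_cubic`). -/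

/-! ### Arithmetic of Eisenstein integers -/

theorem zetaE_sq : zetaE ^ 2 + zetaE + 1 = 0 := by
  have hp : IsPrimitiveRoot zeta3 3 := Complex.isPrimitiveRoot_exp 3 (by norm_num)
  have h := hp.geom_sum_eq_zero (by norm_num)
  apply Subtype.ext
  simp only [Finset.sum_range_succ, Finset.sum_range_zero] at h
  change zeta3 ^ 2 + zeta3 + 1 = 0
  linear_combination h

theorem eisenstein_eq_zero_iff (x y : ℤ) :
    (x : EisensteinRing) + y * zetaE = 0 ↔ x = 0 ∧ y = 0 := by
  constructor
  · intro h
    have hz := zetaE_sq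
    have hN : ((x ^ 2 - x * y + y ^ 2 : ℤ) : EisensteinRing) = 0 := by
      push_cast
      linear_combination (x - y - y * zetaE) * h + (y : EisensteinRing) ^ 2 * hz
    have hN' : x ^ 2 - x * y + y ^ 2 = 0 := by exact_mod_cast hN
    constructor <;> nlinarith [sq_nonneg (2 * x - y), sq_nonneg (2 * y - x)]
  · rintro ⟨rfl, rfl⟩
    simp

theorem eisenstein_ext {x y u v : ℤ}
    (h : (x : EisensteinRing) + y * zetaE = u + v * zetaE) : x = u ∧ y = v := by
  have h1 : ((x - u : ℤ) : EisensteinRing) + ((y - v : ℤ) : EisensteinRing) * zetaE = 0 := by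
    push_cast
    linear_combination h
  obtain ⟨h2, h3⟩ := (eisenstein_eq_zero_iff _ _).1 h1
  exact ⟨by linarith, by linarith⟩

theorem eisenstein_exists_int (z : EisensteinRing) : ∃ x y : ℤ, z = x + y * zetaE := by
  obtain ⟨z, hz⟩ := z
  induction hz using Algebra.adjoin_induction with
  | mem x hx =>
    refine ⟨0, 1, ?_⟩
    rw [Set.mem_singleton_iff] at hx
    subst hx
    simp [zetaE]
  | algebraMap r => exact ⟨r, 0, by apply Subtype.ext; simp⟩
  | add x y hx hy h1 h2 =>
    obtain ⟨a, b, h1⟩ := h1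
    obtain ⟨u, v, h2⟩ := h2
    refine ⟨a + u, b + v, ?_⟩
    have : (⟨x + y, add_mem hx hy⟩ : EisensteinRing) = ⟨x, hx⟩ + ⟨y, hy⟩ := rfl
    rw [this, h1, h2]
    push_cast
    ring
  | mul x y hx hy h1 h2 =>
    obtain ⟨a, b, h1⟩ := h1
    obtain ⟨u, v, h2⟩ := h2
    refine ⟨a * u - b * v, a * v + b * u - b * v, ?_⟩
    have : (⟨x * y, mul_mem hx hy⟩ : EisensteinRing) = ⟨x, hx⟩ * ⟨y, hy⟩ := rfl
    rw [this, h1, h2]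
    push_cast
    linear_combination (b * v : EisensteinRing) * zetaE_sq

/-- Eisenstein integers with coprime coordinates and norm prime to `3` are coprime to their
conjugates. -/
theorem isCoprime_conj {x y : ℤ} (hxy : IsCoprime x y)
    (h3 : IsCoprime 3 (x ^ 2 - x * y + y ^ 2)) :
    IsCoprime ((x : EisensteinRing) + y * zetaE) (x + y * zetaE ^ 2) := by
  obtain ⟨p, q, hpq⟩ := hxy
  obtain ⟨r, s, hrs⟩ := h3
  have hpq' : (p : EisensteinRing) * x + q * y = 1 := by exact_mod_cast congrArg (Int.cast) hpq
  have hrs' : (r : EisensteinRing) * 3 + s * (x ^ 2 - x * y + y ^ 2) = 1 := by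
    exact_mod_cast congrArg (Int.cast) hrs
  have hz := zetaE_sq
  have hz3 : zetaE ^ 3 = 1 := by linear_combination (zetaE - 1) * hz
  have hN : ((x : EisensteinRing) + y * zetaE) * (x + y * zetaE ^ 2) =
      x ^ 2 - x * y + y ^ 2 := by
    linear_combination (x * y : EisensteinRing) * hz + (y ^ 2 : EisensteinRing) * hz3
  -- Bézout coefficients of x, y put ζ - ζ² in the ideal generated by the two conjugates; its
  -- negated square is 3, which is prime to the norm.
  have hd : zetaE - zetaE ^ 2 = (q - p * zetaE ^ 2) * ((x : EisensteinRing) + y * zetaE) +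
      (-q + p * zetaE) * (x + y * zetaE ^ 2) := by
    linear_combination (zetaE ^ 2 - zetaE) * hpq'
  have h3' : (3 : EisensteinRing) = -(zetaE - zetaE ^ 2) * (zetaE - zetaE ^ 2) := by
    linear_combination (3 - 3 * zetaE + zetaE ^ 2) * hz
  refine ⟨-(r * (zetaE - zetaE ^ 2)) * (q - p * zetaE ^ 2) +
      s * (x + y * zetaE ^ 2), -(r * (zetaE - zetaE ^ 2)) * (-q + p * zetaE), ?_⟩
  linear_combination hrs' + (r * (zetaE - zetaE ^ 2)) * hd - r * h3' + s * hN

theorem dvd_mul_of_dvd_of_isCoprime {R : Type*} [CommRing R] {N A A' a a' : R}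
    (h1 : N ∣ A * A') (h2 : N ∣ a * a') (ha : IsCoprime a A') : N ∣ A * a' := by
  obtain ⟨s, t, hst⟩ := ha
  have : A * a' = s * A * (a * a') + t * a' * (A * A') := by
    linear_combination (-(A * a')) * hst
  rw [this]
  exact dvd_add (h2.mul_left _) (h1.mul_left _)

/-- The product `A · ā³` is divisible by `e² c³`, when `a ∣ A`, the norm of `A`
is `d e² c³` and the norm of `a` is `e c`. -/
theorem exists_quotient {x y u v d e c : ℤ} (hxy : IsCoprime x y)
    (hN : x ^ 2 - x * y + y ^ 2 = d * e ^ 2 * c ^ 3)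
    (h3 : IsCoprime 3 (x ^ 2 - x * y + y ^ 2))
    (hec : e * c = u ^ 2 - u * v + v ^ 2)
    (hdvd : (u : EisensteinRing) + v * zetaE ∣ x + y * zetaE) :
    ∃ b₀ b₁ : ℤ, (e ^ 2 * c ^ 3 : EisensteinRing) * (b₀ + b₁ * zetaE) =
      (x + y * zetaE) * (u + v * zetaE ^ 2) ^ 3 := by
  have hz := zetaE_sq
  have hz3 : zetaE ^ 3 = 1 := by linear_combination (zetaE - 1) * hz
  have hN' : (x ^ 2 - x * y + y ^ 2 : EisensteinRing) = d * e ^ 2 * c ^ 3 := by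
    exact_mod_cast congrArg (Int.cast) hN
  have hec' : (e * c : EisensteinRing) = u ^ 2 - u * v + v ^ 2 := by
    exact_mod_cast congrArg (Int.cast) hec
  have hcop := isCoprime_conj hxy h3
  have h1 : (e ^ 2 * c ^ 3 : EisensteinRing) ∣ (x + y * zetaE) * (x + y * zetaE ^ 2) :=
    ⟨d, by
      linear_combination (x * y : EisensteinRing) * hz + (y ^ 2 : EisensteinRing) * hz3 + hN'⟩
  have h2 : (e ^ 2 * c ^ 3 : EisensteinRing) ∣ (u + v * zetaE) ^ 3 * (u + v * zetaE ^ 2) ^ 3 := by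
    refine ⟨e, ?_⟩
    have : ((u : EisensteinRing) + v * zetaE) * (u + v * zetaE ^ 2) = e * c := by
      linear_combination (u * v : EisensteinRing) * hz + (v ^ 2 : EisensteinRing) * hz3 - hec'
    rw [← mul_pow, this]
    ring
  obtain ⟨z, hz⟩ := dvd_mul_of_dvd_of_isCoprime h1 h2 ((hcop.of_isCoprime_of_dvd_left hdvd).pow_left)
  obtain ⟨b₀, b₁, rfl⟩ := eisenstein_exists_int z
  exact ⟨b₀, b₁, hz.symm⟩

/-! ### Residues modulo 3 and the quotient b -/

/-- Every positive divisor prime to `3` of a number `n² + 3n + 9` is `1` modulo `3`. -/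
theorem dvd_modEq_one {n : ℤ} (k : ℕ) (hk : (k : ℤ) ∣ n ^ 2 + 3 * n + 9) (h3 : ¬ 3 ∣ k) :
    k % 3 = 1 := by
  induction k using Nat.recOnMul with
  | zero => simp at h3
  | one => rfl
  | prime p hp =>
    have := Fact.mk hp
    have h3p : (3 : ZMod p) ≠ 0 := by
      intro h
      have : ((3 : ℕ) : ZMod p) = 0 := by exact_mod_cast h
      rw [ZMod.natCast_eq_zero_iff] at this
      exact h3 ((Nat.prime_dvd_prime_iff_eq hp Nat.prime_three).1 this ▸ dvd_rfl)
    have h0 : ((n ^ 2 + 3 * n + 9 : ℤ) : ZMod p) = 0 := (ZMod.intCast_zmod_eq_zero_iff_dvd _ _).2 hk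
    push_cast at h0
    -- n/3 is a root of t² + t + 1 modulo p, hence has order 3, which forces 3 ∣ p - 1.
    set t : ZMod p := n / 3 with ht
    have hn : (n : ZMod p) = 3 * t := by rw [ht]; field_simp
    rw [hn] at h0
    have ht2 : t ^ 2 + t + 1 = 0 := by
      have : (3 : ZMod p) * 3 * (t ^ 2 + t + 1) = 0 := by linear_combination h0
      simpa [h3p] using this
    have ht3 : t ^ 3 = 1 := by linear_combination (t - 1) * ht2
    have ht1 : t ≠ 1 := by
      intro h
      rw [h] at ht2
      exact h3p (by linear_combination ht2)
    have ho : orderOf t = 3 := orderOf_eq_prime ht3 ht1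
    have ht0 : t ≠ 0 := by
      intro h
      rw [h] at ht3
      simp at ht3
    have hdv : 3 ∣ p - 1 := by
      rw [← ho]
      exact orderOf_dvd_of_pow_eq_one (ZMod.pow_card_sub_one_eq_one ht0)
    have := hp.two_le
    omega
  | mul a b ha hb =>
    have h1 := ha ((Int.natCast_dvd_natCast.2 (dvd_mul_right a b)).trans hk)
      (fun h => h3 (h.mul_right _))
    have h2 := hb ((Int.natCast_dvd_natCast.2 (dvd_mul_left b a)).trans hk)
      (fun h => h3 (h.mul_left _))
    rw [Nat.mul_mod, h1, h2]

theorem int_dvd_modEq_one {n k : ℤ} (hpos : 0 < k) (hk : k ∣ n ^ 2 + 3 * n + 9)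
    (h3 : ¬ 3 ∣ k) : k % 3 = 1 := by
  lift k to ℕ using hpos.le
  have := dvd_modEq_one k hk (by exact_mod_cast h3)
  omega

/-- The polynomials come from (u + vζ²)³ = (u³ - 3u²v + v³) + 3uv(v - u)ζ. -/
theorem exists_quotient_coords {x y u v d e c : ℤ} (hxy : IsCoprime x y)
    (hN : x ^ 2 - x * y + y ^ 2 = d * e ^ 2 * c ^ 3)
    (h3 : IsCoprime 3 (x ^ 2 - x * y + y ^ 2))
    (hec : e * c = u ^ 2 - u * v + v ^ 2)
    (hdvd : (u : EisensteinRing) + v * zetaE ∣ x + y * zetaE) :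
    ∃ b₀ b₁ : ℤ,
      e ^ 2 * c ^ 3 * b₀ = x * (u ^ 3 - 3 * u ^ 2 * v + v ^ 3) - 3 * y * (u * v * (v - u)) ∧
      e ^ 2 * c ^ 3 * b₁ =
        y * (u ^ 3 - 3 * u ^ 2 * v + v ^ 3) + 3 * (x - y) * (u * v * (v - u)) := by
  obtain ⟨b₀, b₁, h⟩ := exists_quotient hxy hN h3 hec hdvd
  refine ⟨b₀, b₁, eisenstein_ext ?_⟩
  have hz := zetaE_sq
  have hz3 : zetaE ^ 3 = 1 := by linear_combination (zetaE - 1) * hz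
  have hcube : ((u : EisensteinRing) + v * zetaE ^ 2) ^ 3 =
      (u ^ 3 - 3 * u ^ 2 * v + v ^ 3) + 3 * (u * v * (v - u)) * zetaE := by
    linear_combination (3 * u ^ 2 * v : EisensteinRing) * hz +
      (3 * u * v ^ 2 * zetaE + v ^ 3 * (zetaE ^ 3 + 1) : EisensteinRing) * hz3
  rw [hcube] at h
  push_cast
  linear_combination h + (3 * y * (u * v * (v - u)) : EisensteinRing) * hz

theorem exists_sign_modEq {k : ℤ} (hk : ¬ (3 : ℤ) ∣ k) :
    ∃ ε : ℤ, (ε = 1 ∨ ε = -1) ∧ ε ≡ k [ZMOD 3] := by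
  have : k % 3 = 1 ∨ k % 3 = 2 := by omega
  rcases this with h | h
  · exact ⟨1, .inl rfl, by simp [Int.ModEq, h]⟩
  · exact ⟨-1, .inr rfl, by simp [Int.ModEq, h]⟩

theorem isCoprime_three_of_not_dvd {k : ℤ} (hk : ¬ (3 : ℤ) ∣ k) : IsCoprime 3 k :=
  (Int.prime_three.coprime_iff_not_dvd).2 hk

theorem zmod_three_eq_one {k : ℤ} (hk : k % 3 = 1) : (k : ZMod 3) = 1 := by
  have : ((k : ℤ) : ZMod 3) = ((1 : ℤ) : ZMod 3) :=
    (ZMod.intCast_eq_intCast_iff k 1 3).2 (by simpa [Int.ModEq] using hk)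
  simpa using this

theorem three_dvd_iff_zmod (k : ℤ) : (3 : ℤ) ∣ k ↔ (k : ZMod 3) = 0 := by
  rw [ZMod.intCast_zmod_eq_zero_iff_dvd]
  rfl

theorem zmod_three_cube (t : ZMod 3) : t ^ 3 = t := ZMod.pow_card t

theorem zmod_three : (3 : ZMod 3) = 0 := rfl

/-- The data attached to the cube of the Lagrange resolvent: the Eisenstein integer `b₀ + b₁ ζ`
equals `A · ā³ / (e² c³)` and is congruent to the sign `ε` modulo `3`. -/
theorem exists_resolvent_data_of_not_dvd {n d e c a₀ a₁ : ℤ} (hn : ¬ (3 : ℤ) ∣ n)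
    (he : 0 < e) (hc : 0 < c) (hΔ : n ^ 2 + 3 * n + 9 = d * e ^ 2 * c ^ 3)
    (hec : e * c = a₀ ^ 2 - a₀ * a₁ + a₁ ^ 2)
    (hdvd : (a₀ : EisensteinRing) + (a₁ : EisensteinRing) * zetaE ∣
      (n : EisensteinRing) + 3 * (1 + zetaE)) :
    ∃ ε b₀ b₁ : ℤ, (ε = 1 ∨ ε = -1) ∧ ε ≡ n * (a₀ + a₁) [ZMOD 3] ∧
      (3 : ℤ) ∣ ε * e * c ^ 2 - n * (a₀ + a₁) ∧
      e ^ 2 * c ^ 3 * b₀ =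
        (n + 3) * (a₀ ^ 3 - 3 * a₀ ^ 2 * a₁ + a₁ ^ 3) - 3 * 3 * (a₀ * a₁ * (a₁ - a₀)) ∧
      e ^ 2 * c ^ 3 * b₁ =
        3 * (a₀ ^ 3 - 3 * a₀ ^ 2 * a₁ + a₁ ^ 3) + 3 * (n + 3 - 3) * (a₀ * a₁ * (a₁ - a₀)) ∧
      (3 : ℤ) ∣ b₀ - ε ∧ (3 : ℤ) ∣ b₁ := by
  have hΔ3 : ¬ (3 : ℤ) ∣ n ^ 2 + 3 * n + 9 := by
    intro h
    have : (3 : ℤ) ∣ n ^ 2 := by omega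
    exact hn (Int.prime_three.dvd_of_dvd_pow this)
  have hN : (n + 3) ^ 2 - (n + 3) * 3 + 3 ^ 2 = n ^ 2 + 3 * n + 9 := by ring
  have hde : e ∣ n ^ 2 + 3 * n + 9 := ⟨d * e * c ^ 3, by rw [hΔ]; ring⟩
  have hdc : c ∣ n ^ 2 + 3 * n + 9 := ⟨d * e ^ 2 * c ^ 2, by rw [hΔ]; ring⟩
  have he1 := zmod_three_eq_one (int_dvd_modEq_one he hde fun h => hΔ3 (h.trans hde))
  have hc1 := zmod_three_eq_one (int_dvd_modEq_one hc hdc fun h => hΔ3 (h.trans hdc))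
  have hcop : IsCoprime (n + 3) 3 := by
    refine (isCoprime_three_of_not_dvd ?_).symm
    omega
  obtain ⟨b₀, b₁, h₀, h₁⟩ := exists_quotient_coords (x := n + 3) (y := 3) (u := a₀) (v := a₁)
    hcop (hN.trans hΔ) (isCoprime_three_of_not_dvd (by rwa [hN])) hec (by
      have : ((n + 3 : ℤ) : EisensteinRing) + ((3 : ℤ) : EisensteinRing) * zetaE =
        n + 3 * (1 + zetaE) := by push_cast; ring
      rwa [this])
  have z0 := zmod_three
  have hecz : (1 : ZMod 3) = (a₀ + a₁) ^ 2 := by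
    have := congrArg (Int.cast (R := ZMod 3)) hec
    push_cast [he1, hc1] at this
    linear_combination this - a₀ * a₁ * z0
  have hk : ¬ (3 : ℤ) ∣ n * (a₀ + a₁) := by
    intro h
    rcases Int.prime_three.dvd_or_dvd h with h | h
    · exact hn h
    · rw [three_dvd_iff_zmod] at h
      push_cast at h
      rw [h] at hecz
      exact absurd hecz (by decide)
  obtain ⟨ε, hε, hεk⟩ := exists_sign_modEq hk
  have hεz : (ε : ZMod 3) = n * (a₀ + a₁) := by
    have := (ZMod.intCast_eq_intCast_iff ε (n * (a₀ + a₁)) 3).2 hεk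
    push_cast at this
    exact this
  refine ⟨ε, b₀, b₁, hε, hεk, ?_, h₀, h₁, ?_, ?_⟩
  · rw [three_dvd_iff_zmod]
    push_cast
    rw [he1, hc1, hεz]
    ring
  · rw [three_dvd_iff_zmod]
    -- Modulo 3 cubing is the identity and e, c are 1, so b₀ ≡ n(a₀ + a₁).
    have := congrArg (Int.cast (R := ZMod 3)) h₀
    push_cast [he1, hc1, z0, zmod_three_cube] at this
    push_cast
    linear_combination this - hεz + (3 * a₀ ^ 2 * a₁ - 3 * a₀ * a₁ ^ 2) * z0
  · rw [three_dvd_iff_zmod]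
    have := congrArg (Int.cast (R := ZMod 3)) h₁
    push_cast [he1, hc1, z0, zmod_three_cube] at this
    linear_combination this

/-- If 3 ∤ c then 27 ∣ de², but for coprime squarefree d, e the 3-adic valuation of de² is at most
2. -/
theorem three_dvd_of_factorization {d e c k : ℤ} (hd : Squarefree d) (he : Squarefree e)
    (hde : IsCoprime d e) (h : d * e ^ 2 * c ^ 3 = 27 * k) : (3 : ℤ) ∣ c := by
  by_contra hc
  have hp := Int.prime_three
  have hcop : IsCoprime (27 : ℤ) (c ^ 3) := by
    have : (27 : ℤ) = 3 ^ 3 := by norm_num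
    rw [this]
    exact (isCoprime_three_of_not_dvd hc).pow
  have h27 : (27 : ℤ) ∣ d * e ^ 2 := hcop.dvd_of_dvd_mul_right ⟨k, h⟩
  have hsq {z : ℤ} (hz : Squarefree z) : ¬ (9 : ℤ) ∣ z := fun h9 =>
    hp.not_isUnit (hz 3 (by simpa using h9))
  by_cases h3e : (3 : ℤ) ∣ e
  · have h3d : ¬ (3 : ℤ) ∣ d := fun h => hp.not_isUnit (hde.isUnit_of_dvd' h h3e)
    have hcop' : IsCoprime (27 : ℤ) d := by
      have : (27 : ℤ) = 3 ^ 3 := by norm_num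
      rw [this]
      exact (isCoprime_three_of_not_dvd h3d).pow_left
    have h2 : (27 : ℤ) ∣ e ^ 2 := hcop'.dvd_of_dvd_mul_left h27
    obtain ⟨t, rfl⟩ := h3e
    have : (3 : ℤ) ∣ t ^ 2 := by
      obtain ⟨s, hs⟩ := h2
      exact ⟨s, by linarith⟩
    obtain ⟨s, rfl⟩ := hp.dvd_of_dvd_pow this
    exact hsq he ⟨s, by ring⟩
  · have hcop' : IsCoprime (27 : ℤ) (e ^ 2) := by
      have : (27 : ℤ) = 3 ^ 3 := by norm_num
      rw [this]
      exact (isCoprime_three_of_not_dvd h3e).pow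
    have := hcop'.dvd_of_dvd_mul_right h27
    exact hsq hd ((by norm_num : (9 : ℤ) ∣ 27).trans this)

/-- Here A = 3(1 - ζ)A' and a = (1 - ζ)a' with A' = (6k + 3) + (3k + 2)ζ and a' = u + vζ, both of
norm prime to 3. The quotient argument is applied to A', a' and c/3. -/
theorem exists_resolvent_data_of_modEq {n d e c a₀ a₁ : ℤ} (hn : n ≡ 12 [ZMOD 27])
    (he : 0 < e) (hc : 0 < c) (hdsq : Squarefree d) (hesq : Squarefree e) (hde : IsCoprime d e)
    (hΔ : n ^ 2 + 3 * n + 9 = d * e ^ 2 * c ^ 3)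
    (hec : e * c = a₀ ^ 2 - a₀ * a₁ + a₁ ^ 2)
    (hdvd : (a₀ : EisensteinRing) + (a₁ : EisensteinRing) * zetaE ∣
      (n : EisensteinRing) + 3 * (1 + zetaE)) :
    ∃ ε b₀ b₁ : ℤ, (ε = 1 ∨ ε = -1) ∧ ε ≡ a₀ [ZMOD 3] ∧
      (3 : ℤ) ∣ ε * e * c ^ 2 - n * (a₀ + a₁) ∧
      e ^ 2 * c ^ 3 * b₀ =
        (n + 3) * (a₀ ^ 3 - 3 * a₀ ^ 2 * a₁ + a₁ ^ 3) - 3 * 3 * (a₀ * a₁ * (a₁ - a₀)) ∧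
      e ^ 2 * c ^ 3 * b₁ =
        3 * (a₀ ^ 3 - 3 * a₀ ^ 2 * a₁ + a₁ ^ 3) + 3 * (n + 3 - 3) * (a₀ * a₁ * (a₁ - a₀)) ∧
      (3 : ℤ) ∣ b₀ - ε ∧ (3 : ℤ) ∣ b₁ := by
  have hz := zetaE_sq
  obtain ⟨k, hk⟩ : ∃ k, n = 12 + 27 * k := by
    obtain ⟨k, hk⟩ := hn.symm.dvd
    exact ⟨k, by linarith⟩
  obtain ⟨c', rfl⟩ : (3 : ℤ) ∣ c :=
    three_dvd_of_factorization (k := 27 * k ^ 2 + 27 * k + 7) hdsq hesq hde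
      (by rw [← hΔ, hk]; ring)
  have hΔ' : (6 * k + 3) ^ 2 - (6 * k + 3) * (3 * k + 2) + (3 * k + 2) ^ 2 =
      d * e ^ 2 * c' ^ 3 := by
    rw [hk] at hΔ
    linarith
  have hΔ3 : ¬ (3 : ℤ) ∣ (6 * k + 3) ^ 2 - (6 * k + 3) * (3 * k + 2) + (3 * k + 2) ^ 2 := by
    have : (6 * k + 3) ^ 2 - (6 * k + 3) * (3 * k + 2) + (3 * k + 2) ^ 2 =
      3 * (9 * k ^ 2 + 9 * k + 2) + 1 := by ring
    omega
  have hcop : IsCoprime (6 * k + 3) (3 * k + 2) := ⟨-1, 2, by ring⟩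
  have h3e : ¬ (3 : ℤ) ∣ e := fun h => hΔ3 (by
    rw [hΔ']; exact ((h.trans (dvd_pow_self e two_ne_zero)).mul_left d).mul_right _)
  have h3c : ¬ (3 : ℤ) ∣ c' := fun h => hΔ3 (by
    rw [hΔ']; exact (h.trans (dvd_pow_self c' three_ne_zero)).mul_left _)
  have he1 := int_dvd_modEq_one he ⟨d * e * (3 * c') ^ 3, by rw [hΔ]; ring⟩ h3e
  have hc1 := int_dvd_modEq_one (k := c') (by linarith)
    ⟨d * e ^ 2 * 27 * c' ^ 2, by rw [hΔ]; ring⟩ h3c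
  have h3ec : ¬ (3 : ℤ) ∣ e * c' := fun h => (Int.prime_three.dvd_or_dvd h).elim h3e h3c
  obtain ⟨v, hv⟩ : (3 : ℤ) ∣ a₀ + a₁ := by
    refine Int.prime_three.dvd_of_dvd_pow (n := 2) ⟨e * c' + a₀ * a₁, ?_⟩
    linear_combination -hec
  obtain ⟨u, hu⟩ : ∃ u, a₀ = u + v := ⟨a₀ - v, by ring⟩
  obtain rfl : a₁ = 2 * v - u := by linarith
  subst hu
  have hec' : e * c' = u ^ 2 - u * v + v ^ 2 := by linarith
  have hdvd' : (u : EisensteinRing) + v * zetaE ∣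
      ((6 * k + 3 : ℤ) : EisensteinRing) + ((3 * k + 2 : ℤ) : EisensteinRing) * zetaE := by
    obtain ⟨z, hzz⟩ := hdvd
    obtain ⟨B₀, B₁, rfl⟩ := eisenstein_exists_int z
    have hnE : (n : EisensteinRing) = 12 + 27 * k := by exact_mod_cast congrArg (Int.cast) hk
    have hecE : (e * c' : EisensteinRing) = u ^ 2 - u * v + v ^ 2 := by
      exact_mod_cast congrArg (Int.cast) hec'
    have hne : (1 - zetaE) ≠ 0 := by
      intro h
      have := (eisenstein_eq_zero_iff 1 (-1)).1 (by push_cast; linear_combination h)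
      omega
    have hq : ((u : EisensteinRing) + v * zetaE) * (B₀ + B₁ * zetaE) =
        3 * ((6 * k + 3) + (3 * k + 2) * zetaE) := by
      apply mul_left_cancel₀ hne
      push_cast at hzz
      rw [hnE] at hzz
      linear_combination -hzz + (-v * (B₀ + B₁ * zetaE) + 3 * (3 * k + 2)) * hz
    -- Multiplying by the conjugate of u + vζ leaves the norm ec' on the left; since 3 ∤ ec', both
    -- B₀ and B₁ are divisible by 3.
    have hq' : ((e * c' * B₀ : ℤ) : EisensteinRing) + ((e * c' * B₁ : ℤ) : EisensteinRing) * zetaE =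
        ((3 * ((6 * k + 3) * (u - v) + (3 * k + 2) * v) : ℤ) : EisensteinRing) +
        ((3 * ((3 * k + 2) * u - (6 * k + 3) * v) : ℤ) : EisensteinRing) * zetaE := by
      push_cast
      linear_combination (B₀ + B₁ * zetaE) * hecE + (u - v - v * zetaE) * hq +
        (v ^ 2 * (B₀ + B₁ * zetaE) - 3 * (3 * k + 2) * v) * hz
    obtain ⟨g₀, g₁⟩ := eisenstein_ext hq'
    obtain ⟨C₀, rfl⟩ := (Int.prime_three.dvd_or_dvd (Dvd.intro _ g₀.symm)).resolve_left h3ec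
    obtain ⟨C₁, rfl⟩ := (Int.prime_three.dvd_or_dvd (Dvd.intro _ g₁.symm)).resolve_left h3ec
    refine ⟨C₀ + C₁ * zetaE, mul_left_cancel₀ (a := (3 : EisensteinRing)) (by norm_num) ?_⟩
    push_cast at hq ⊢
    linear_combination -hq
  obtain ⟨b₀, b₁, h₀, h₁⟩ := exists_quotient_coords hcop hΔ' (isCoprime_three_of_not_dvd hΔ3)
    hec' hdvd'
  have z0 := zmod_three
  have he1' := zmod_three_eq_one he1
  have hc1' := zmod_three_eq_one hc1
  have hecz : (1 : ZMod 3) = (u + v) ^ 2 := by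
    have := congrArg (Int.cast (R := ZMod 3)) hec'
    push_cast [he1', hc1'] at this
    linear_combination this - u * v * z0
  have hk : ¬ (3 : ℤ) ∣ u + v := by
    intro h
    rw [three_dvd_iff_zmod] at h
    push_cast at h
    rw [h] at hecz
    exact absurd hecz (by decide)
  obtain ⟨ε, hε, hεk⟩ := exists_sign_modEq hk
  have hεz : (ε : ZMod 3) = u + v := by
    have := (ZMod.intCast_eq_intCast_iff ε (u + v) 3).2 hεk
    push_cast at this
    exact this
  have g₀ := congrArg (Int.cast (R := ZMod 3)) h₀
  have g₁ := congrArg (Int.cast (R := ZMod 3)) h₁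
  push_cast [he1', hc1', z0, zmod_three_cube] at g₀ g₁
  -- Since 3(1 - ζ)(1 - ζ²)³ = -27ζ², the wanted quotient is -ζ² = 1 + ζ times the reduced one.
  refine ⟨ε, b₀ - b₁, b₀, hε, hεk, ?_, ?_, ?_, ?_, ?_⟩
  · exact ⟨ε * e * 3 * c' ^ 2 - n * v, by ring⟩
  · rw [‹n = _›]
    linear_combination 27 * h₀ - 27 * h₁
  · rw [‹n = _›]
    linear_combination 27 * h₀
  · rw [three_dvd_iff_zmod]
    push_cast
    linear_combination g₀ - g₁ - hεz + (2 * k * (u + v) - (u + v)) * z0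
  · rw [three_dvd_iff_zmod]
    linear_combination g₀ + 2 * k * (u + v) * z0

/-! ### Traces and normal integral bases in cyclic cubic fields -/

/-- If `z³ ∈ f 𝓞`, then the squarefree integer `f` divides the trace of `z`; here the trace is
written through the three conjugates. -/
theorem squarefree_dvd_of_cube_sums {f s₁ s₂ s₃ p q r : ℤ} (hf : Squarefree f)
    (h1 : s₁ ^ 3 - 3 * s₁ * s₂ + 3 * s₃ = f * p)
    (h2 : s₂ ^ 3 - 3 * s₂ * s₁ * s₃ + 3 * s₃ ^ 2 = f * q)
    (h3 : s₃ ^ 3 = f * r) : f ∣ s₁ := by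
  -- The hypotheses concern the elementary symmetric functions of the cubes; divisibility passes
  -- from s₃ to s₂ to s₁.
  have d3 : f ∣ s₃ := (hf.dvd_pow_iff_dvd (n := 3) (by norm_num)).1 ⟨r, h3⟩
  obtain ⟨k, hk⟩ := d3
  have d2 : f ∣ s₂ := (hf.dvd_pow_iff_dvd (n := 3) (by norm_num)).1
    ⟨q + 3 * s₂ * s₁ * k - 3 * k * s₃, by linear_combination h2 + (3 * s₂ * s₁ - 3 * s₃) * hk⟩
  obtain ⟨l, hl⟩ := d2
  exact (hf.dvd_pow_iff_dvd (n := 3) (by norm_num)).1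
    ⟨p + 3 * s₁ * l - 3 * k, by linear_combination h1 + 3 * s₁ * hl - 3 * hk⟩

section CyclicCubic

variable {K : Type*} [Field K] [Algebra ℚ K]

theorem exists_int_of_fixed {σ : K ≃ₐ[ℚ] K}
    (hfix : ∀ x : K, σ x = x → ∃ q : ℚ, x = algebraMap ℚ K q) {x : K} (hx : IsIntegral ℤ x)
    (h : σ x = x) : ∃ k : ℤ, x = k := by
  obtain ⟨q, rfl⟩ := hfix x h
  have hq : IsIntegral ℤ q := (isIntegral_algebraMap_iff (algebraMap ℚ K).injective).1 hx
  obtain ⟨k, hk⟩ := IsIntegrallyClosed.isIntegral_iff.1 hq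
  exact ⟨k, by rw [← hk]; simp⟩

theorem isIntegral_conj (σ : K ≃ₐ[ℚ] K) {x : K} (hx : IsIntegral ℤ x) : IsIntegral ℤ (σ x) :=
  hx.map (σ : K →ₐ[ℚ] K)

theorem exists_int_trace {σ : K ≃ₐ[ℚ] K} (hσ : ∀ x, σ (σ (σ x)) = x)
    (hfix : ∀ x : K, σ x = x → ∃ q : ℚ, x = algebraMap ℚ K q) {x : K} (hx : IsIntegral ℤ x) :
    ∃ k : ℤ, x + σ x + σ (σ x) = k :=
  exists_int_of_fixed hfix
    ((hx.add (isIntegral_conj σ hx)).add (isIntegral_conj σ (isIntegral_conj σ hx)))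
    (by simp only [map_add, hσ]; ring)

/-- The symmetric functions of the conjugates of z and of w are integers, being integral and fixed
by σ, so the claim becomes one about integers. -/
theorem dvd_trace_of_cube_eq {σ : K ≃ₐ[ℚ] K} (hσ : ∀ x, σ (σ (σ x)) = x)
    (hfix : ∀ x : K, σ x = x → ∃ q : ℚ, x = algebraMap ℚ K q) {f : ℤ} (hf : Squarefree f)
    {z w : K} (hz : IsIntegral ℤ z) (hw : IsIntegral ℤ w) (h : z ^ 3 = f * w) :
    ∃ k : ℤ, z + σ z + σ (σ z) = f * k := by
  have : CharZero K := algebraRat.charZero K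
  have hz' := isIntegral_conj σ hz
  have hz'' := isIntegral_conj σ hz'
  have hw' := isIntegral_conj σ hw
  have hw'' := isIntegral_conj σ hw'
  have h' : (σ z) ^ 3 = f * σ w := by rw [← map_pow, h]; simp
  have h'' : (σ (σ z)) ^ 3 = f * σ (σ w) := by rw [← map_pow, h']; simp
  obtain ⟨s₁, hs₁⟩ := exists_int_trace hσ hfix hz
  obtain ⟨s₂, hs₂⟩ := exists_int_trace hσ hfix (hz.mul hz')
  obtain ⟨s₃, hs₃⟩ := exists_int_of_fixed hfix ((hz.mul hz').mul hz'')
    (by simp only [map_mul, hσ]; ring)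
  obtain ⟨p, hp⟩ := exists_int_trace hσ hfix hw
  obtain ⟨q, hq⟩ := exists_int_trace hσ hfix (hw.mul hw')
  obtain ⟨r, hr⟩ := exists_int_of_fixed hfix ((hw.mul hw').mul hw'')
    (by simp only [map_mul, hσ]; ring)
  simp only [map_mul, hσ] at hs₂ hq
  obtain ⟨k, hk⟩ : f ∣ s₁ := by
    refine squarefree_dvd_of_cube_sums (s₂ := s₂) (s₃ := s₃) (p := p) (q := f * q)
      (r := f ^ 2 * r) hf ?_ ?_ ?_
    · have : ((s₁ ^ 3 - 3 * s₁ * s₂ + 3 * s₃ : ℤ) : K) = ((f * p : ℤ) : K) := by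
        push_cast
        rw [← hs₁, ← hs₂, ← hs₃, ← hp]
        linear_combination h + h' + h''
      exact_mod_cast this
    · have : ((s₂ ^ 3 - 3 * s₂ * s₁ * s₃ + 3 * s₃ ^ 2 : ℤ) : K) = ((f * (f * q) : ℤ) : K) := by
        push_cast
        rw [← hs₁, ← hs₂, ← hs₃, ← hq]
        linear_combination (σ z) ^ 3 * h + (f : K) * w * h' + (σ (σ z)) ^ 3 * h' +
          (f : K) * σ w * h'' + z ^ 3 * h'' + (f : K) * σ (σ w) * h
      exact_mod_cast this
    · have : ((s₃ ^ 3 : ℤ) : K) = ((f * (f ^ 2 * r) : ℤ) : K) := by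
        push_cast
        rw [← hs₃, ← hr, mul_pow, mul_pow, h, h', h'']
        ring
      exact_mod_cast this
  exact ⟨k, by rw [hs₁, hk]; push_cast; ring⟩

/-- In a cyclic cubic field, let `y` have trace `0` and `y³ = 3 f y + f T` for a squarefree
`f ≡ 1 (mod 3)`, where `27 ∣ ε + f T - 3 ε f`. Then `(y + ε) / 3` generates a normal integral
basis. -/
theorem isNormalIntegralBasisGenerator_of_cubic [FiniteDimensional ℚ K] [IsGalois ℚ K]
    {σ : K ≃ₐ[ℚ] K} (hσ1 : σ ≠ 1) (hσσ : σ * σ ≠ 1) (hσ : ∀ x, σ (σ (σ x)) = x)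
    (hall : ∀ τ : K ≃ₐ[ℚ] K, τ = 1 ∨ τ = σ ∨ τ = σ * σ)
    {f T ε : ℤ} (hf : Squarefree f) (hf3 : f % 3 = 1) (hε : ε ^ 2 = 1)
    (h27 : (27 : ℤ) ∣ ε + f * T - 3 * ε * f) {α y : K} (hα : 3 * α = y + ε)
    (hy0 : y + σ y + σ (σ y) = 0)
    (hy2 : y * σ y + σ y * σ (σ y) + σ (σ y) * y = -3 * f)
    (hy3 : y ^ 3 = f * (3 * y + T)) :
    IsNormalIntegralBasisGenerator K α := by
  have : CharZero K := algebraRat.charZero K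
  refine ⟨inferInstance, inferInstance, ?_⟩
  have hfix : ∀ x : K, σ x = x → ∃ q : ℚ, x = algebraMap ℚ K q := by
    intro x hx
    have : x ∈ (⊥ : IntermediateField ℚ K) := by
      rw [IsGalois.mem_bot_iff_fixed]
      intro τ
      rcases hall τ with rfl | rfl | rfl
      · rfl
      · exact hx
      · simp [AlgEquiv.mul_apply, hx]
    obtain ⟨q, hq⟩ := IntermediateField.mem_bot.1 this
    exact ⟨q, hq.symm⟩
  have hf0 : (f : K) ≠ 0 := by
    have : f ≠ 0 := by omega
    exact_mod_cast this
  obtain ⟨g, hg⟩ : (3 : ℤ) ∣ 1 - f := by omega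
  obtain ⟨h, hh⟩ := h27
  have hgK : (1 : K) - f = 3 * g := by exact_mod_cast congrArg (Int.cast (R := K)) hg
  have hhK : (ε : K) + f * T - 3 * ε * f = 27 * h := by
    exact_mod_cast congrArg (Int.cast (R := K)) hh
  have hεK : (ε : K) ^ 2 = 1 := by exact_mod_cast congrArg (Int.cast (R := K)) hε
  have hyα : y = 3 * α - ε := by linear_combination -hα
  have hαint : IsIntegral ℤ α := by
    -- The cubic of y at y = 3α - ε, divided by 27.
    refine ⟨X ^ 3 - C ε * X ^ 2 + C g * X - C h, by monicity!, ?_⟩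
    have : (27 : K) * (α ^ 3 - ε * α ^ 2 + g * α - h) = 0 := by
      rw [hyα] at hy3
      linear_combination hy3 - 9 * α * hgK + hhK + (ε - 9 * α) * hεK
    have h0 := (mul_eq_zero.1 this).resolve_left (by norm_num)
    simp only [eval₂_add, eval₂_sub, eval₂_mul, eval₂_pow, eval₂_X, eval₂_C]
    simpa only [eq_intCast] using h0
  have hy0' : σ (σ y) = -y - σ y := by linear_combination hy0
  have hyy : y ^ 2 + y * σ y + σ y ^ 2 = 3 * f := by
    rw [hy0'] at hy2
    linear_combination -hy2
  have hσ3 : σ 3 = 3 := map_ofNat σ 3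
  have hy3' : σ y ^ 3 = f * (3 * σ y + T) := by rw [← map_pow, hy3]; simp [hσ3]
  have hy3'' : σ (σ y) ^ 3 = f * (3 * σ (σ y) + T) := by rw [← map_pow, hy3']; simp [hσ3]
  have hα' : 3 * σ α = σ y + ε := by simpa [hσ3] using congrArg σ hα
  have hα'' : 3 * σ (σ α) = σ (σ y) + ε := by simpa [hσ3] using congrArg σ hα'
  have hα'int := isIntegral_conj σ hαint
  have hα''int := isIntegral_conj σ hα'int
  have hcast (k : ℤ) : IsIntegral ℤ (k : K) := by
    simpa using isIntegral_algebraMap (R := ℤ) (A := K) (x := k)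
  have hint (z : K) (β : K) (hβ : IsIntegral ℤ β) (h : 3 * β = z + ε) : IsIntegral ℤ z := by
    have : z = ((3 : ℤ) : K) * β - ε := by push_cast; linear_combination -h
    rw [this]
    exact ((hcast 3).mul hβ).sub (hcast ε)
  have hdvd {x z : K} (hx : IsIntegral ℤ x) (hz : IsIntegral ℤ z)
      (h : z ^ 3 = f * (3 * z + T)) : ∃ k : ℤ, x * z + σ (x * z) + σ (σ (x * z)) = f * k := by
    refine dvd_trace_of_cube_eq hσ hfix hf (hx.mul hz)
      (w := x ^ 3 * (((3 : ℤ) : K) * z + T))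
      ((hx.pow 3).mul (((hcast 3).mul hz).add (hcast T))) ?_
    rw [mul_pow, h]
    push_cast
    ring
  have hcoef {x z β : K} (hx : IsIntegral ℤ x) (hβ : IsIntegral ℤ β) (hβz : 3 * β = z + ε)
      (h : z ^ 3 = f * (3 * z + T)) :
      ∃ u : ℤ, 3 * f * (u : K) = (x * z + σ (x * z) + σ (σ (x * z))) +
        f * ε * (x + σ x + σ (σ x)) := by
    obtain ⟨k, hk⟩ := hdvd hx (hint z β hβ hβz) h
    obtain ⟨t, ht⟩ := exists_int_trace hσ hfix (hx.mul hβ)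
    -- From Tr(xz) = fk and 3t = fk + ε Tr(x), the coordinate (k + ε Tr(x))/3 equals t + k(1 - f)/3.
    refine ⟨t + g * k, ?_⟩
    have hβz' : 3 * σ β = σ z + ε := by simpa [hσ3] using congrArg σ hβz
    have hβz'' : 3 * σ (σ β) = σ (σ z) + ε := by simpa [hσ3] using congrArg σ hβz'
    push_cast
    rw [← ht]
    simp only [map_mul] at hk ⊢
    linear_combination f * x * hβz + f * σ x * hβz' + f * σ (σ x) * hβz'' - f * k * hgK +
      (f - 1) * hk
  have hsum {M : Type _} [AddCommMonoid M] (F : (K ≃ₐ[ℚ] K) → M) :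
      ∑ τ, F τ = F 1 + F σ + F (σ * σ) := by
    classical
    have hu : (Finset.univ : Finset (K ≃ₐ[ℚ] K)) = {1, σ, σ * σ} := by
      ext τ
      simpa using hall τ
    have hne : σ ≠ σ * σ := fun h => hσ1 (mul_eq_left.1 h.symm)
    rw [hu, Finset.sum_insert (by simp [hσ1.symm, hσσ.symm]), Finset.sum_insert (by simpa using hne),
      Finset.sum_singleton, add_assoc]
  let v : (K ≃ₐ[ℚ] K) → 𝓞 K := fun τ => ⟨τ α, hαint.map (τ : K →ₐ[ℚ] K)⟩
  have hcoe (k : ℤ) (τ : K ≃ₐ[ℚ] K) : algebraMap (𝓞 K) K (k • v τ) = k * τ α := by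
    rw [map_zsmul, zsmul_eq_mul]
    rfl
  have hv : LinearIndependent ℤ v := by
    rw [Fintype.linearIndependent_iff]
    intro a ha
    rw [hsum] at ha
    have h1 : (a 1 : K) * α + a σ * σ α + a (σ * σ) * σ (σ α) = 0 := by
      have := congrArg (algebraMap (𝓞 K) K) ha
      rwa [map_add, map_add, hcoe, hcoe, hcoe, map_zero] at this
    have h2 : (a 1 : K) * σ α + a σ * σ (σ α) + a (σ * σ) * α = 0 := by
      simpa [hσ] using congrArg σ h1
    have h3 : (a 1 : K) * σ (σ α) + a σ * α + a (σ * σ) * σ α = 0 := by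
      simpa [hσ] using congrArg σ h2
    -- Adding the three conjugate relations leaves the coefficient sum times Tr(α) = ε, a unit.
    have hs : (a 1 : K) + a σ + a (σ * σ) = 0 := by
      have hTr : α + σ α + σ (σ α) = ε := by
        have : (3 : K) * (α + σ α + σ (σ α)) = 3 * ε := by
          linear_combination hα + hα' + hα'' + hy0
        exact mul_left_cancel₀ (by norm_num) this
      linear_combination ε * h1 + ε * h2 + ε * h3 - (a 1 + a σ + a (σ * σ)) * ε * hTr -
        (a 1 + a σ + a (σ * σ)) * hεK
    have e1 : ((a 1 : K) - a (σ * σ)) * y + (a σ - a (σ * σ)) * σ y = 0 := by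
      linear_combination 3 * h1 - a 1 * hα - a σ * hα' - a (σ * σ) * hα'' - a (σ * σ) * hy0' -
        ε * hs
    have e2 : ((a 1 : K) - a (σ * σ)) * σ y - (a σ - a (σ * σ)) * (y + σ y) = 0 := by
      linear_combination 3 * h2 - a 1 * hα' - a σ * hα'' - a (σ * σ) * hα - a σ * hy0' -
        ε * hs
    -- `e1` and `e2` form a linear system of determinant -(y² + yσy + (σy)²) = -3f ≠ 0.
    have p0 : (a 1 : K) - a (σ * σ) = 0 := by
      have : (3 * f : K) * ((a 1 : K) - a (σ * σ)) = 0 := by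
        linear_combination (y + σ y) * e1 + σ y * e2 - ((a 1 : K) - a (σ * σ)) * hyy
      exact (mul_eq_zero.1 this).resolve_left (mul_ne_zero (by norm_num) hf0)
    have q0 : (a σ : K) - a (σ * σ) = 0 := by
      have : (3 * f : K) * ((a σ : K) - a (σ * σ)) = 0 := by
        linear_combination σ y * e1 - y * e2 - ((a σ : K) - a (σ * σ)) * hyy
      exact (mul_eq_zero.1 this).resolve_left (mul_ne_zero (by norm_num) hf0)
    have hs' : a 1 + a σ + a (σ * σ) = 0 := by exact_mod_cast hs
    have p0' : a 1 - a (σ * σ) = 0 := by exact_mod_cast p0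
    have q0' : a σ - a (σ * σ) = 0 := by exact_mod_cast q0
    intro τ
    rcases hall τ with rfl | rfl | rfl <;> omega
  have hspan : ⊤ ≤ Submodule.span ℤ (Set.range v) := by
    intro x _
    have hx : IsIntegral ℤ (x : K) := x.2
    obtain ⟨u₀, h₀⟩ := hcoef hx hαint hα hy3
    obtain ⟨u₁, h₁⟩ := hcoef hx hα'int hα' hy3'
    obtain ⟨u₂, h₂⟩ := hcoef hx hα''int hα'' hy3''
    -- Expansion of x using the dual basis of conjugates of (y + fε)/(3f).
    have key : (x : K) = u₀ * α + u₁ * σ α + u₂ * σ (σ α) := by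
      have : (9 * f : K) * x = 9 * f * (u₀ * α + u₁ * σ α + u₂ * σ (σ α)) := by
        simp only [map_mul, hy0', map_sub, map_neg] at h₀ h₁ h₂ hα''
        linear_combination (-3 * α) * h₀ - 3 * σ α * h₁ - 3 * σ (σ α) * h₂ -
          (x * y + σ x * σ y + σ (σ x) * (-y - σ y) + f * ε * (x + σ x + σ (σ x))) * hα -
          (x * σ y + σ x * (-y - σ y) + σ (σ x) * y + f * ε * (x + σ x + σ (σ x))) * hα' -
          (x * (-y - σ y) + σ x * y + σ (σ x) * σ y + f * ε * (x + σ x + σ (σ x))) * hα'' -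
          (2 * x - σ x - σ (σ x)) * hyy - 3 * f * (x + σ x + σ (σ x)) * hεK
      exact mul_left_cancel₀ (mul_ne_zero (by norm_num) hf0) this
    have hxv : x = u₀ • v 1 + u₁ • v σ + u₂ • v (σ * σ) := by
      apply NumberField.RingOfIntegers.ext
      change (x : K) = algebraMap (𝓞 K) K _
      rw [map_add, map_add, hcoe, hcoe, hcoe]
      exact key
    rw [hxv]
    exact add_mem (add_mem (Submodule.smul_mem _ _ (Submodule.subset_span ⟨_, rfl⟩))
      (Submodule.smul_mem _ _ (Submodule.subset_span ⟨_, rfl⟩)))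
      (Submodule.smul_mem _ _ (Submodule.subset_span ⟨_, rfl⟩))
  exact ⟨Module.Basis.mk hv hspan, fun τ => by rw [Module.Basis.mk_apply]; rfl⟩

end CyclicCubic

/-! ### Shanks' polynomial and its Galois group -/

theorem aeval_shanksPoly {A : Type*} [CommRing A] (n : ℤ) (x : A) :
    aeval x (shanksPoly n) = x ^ 3 - n * x ^ 2 - (n + 3) * x - 1 := by
  simp only [shanksPoly, map_sub, map_mul, map_pow, aeval_X, map_one, aeval_C]
  simp

/-- The cubic relation makes r² - (n + 1)r - 2 a polynomial form of -1/(1 + r). -/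
theorem shanks_conj_root {A : Type*} [CommRing A] {n r : A}
    (h : r ^ 3 - n * r ^ 2 - (n + 3) * r - 1 = 0) :
    (r ^ 2 - (n + 1) * r - 2) ^ 3 - n * (r ^ 2 - (n + 1) * r - 2) ^ 2 -
      (n + 3) * (r ^ 2 - (n + 1) * r - 2) - 1 = 0 := by
  grind

theorem shanks_conj_conj {A : Type*} [CommRing A] {n r : A}
    (h : r ^ 3 - n * r ^ 2 - (n + 3) * r - 1 = 0) :
    (r ^ 2 - (n + 1) * r - 2) ^ 2 - (n + 1) * (r ^ 2 - (n + 1) * r - 2) - 2 =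
      n - r - (r ^ 2 - (n + 1) * r - 2) := by
  grind

theorem shanks_factor {A : Type*} [CommRing A] {n r : A}
    (h : r ^ 3 - n * r ^ 2 - (n + 3) * r - 1 = 0) (x : A) :
    x ^ 3 - n * x ^ 2 - (n + 3) * x - 1 =
      (x - r) * (x - (r ^ 2 - (n + 1) * r - 2)) * (x - (n - r - (r ^ 2 - (n + 1) * r - 2))) := by
  grind

theorem shanksPoly_monic (n : ℤ) : (shanksPoly n).Monic := by
  unfold shanksPoly
  monicity!

theorem shanksPoly_natDegree (n : ℤ) : (shanksPoly n).natDegree = 3 := by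
  unfold shanksPoly
  compute_degree!

theorem shanksPoly_irreducible (n : ℤ) : Irreducible (shanksPoly n) := by
  have hd := shanksPoly_natDegree n
  rw [(shanksPoly_monic n).irreducible_iff_roots_eq_zero_of_degree_le_three (by omega) (by omega)]
  rw [Multiset.eq_zero_iff_forall_notMem]
  intro x hx
  have hx' := isRoot_of_mem_roots hx
  simp only [shanksPoly, IsRoot.def, eval_sub, eval_mul, eval_pow, eval_X, eval_C, eval_one] at hx'
  have hu : IsUnit x := isUnit_of_dvd_one ⟨x ^ 2 - n * x - (n + 3), by linear_combination -hx'⟩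
  -- The values at 1 and -1 are -2n - 3, which is odd, and 1.
  rcases Int.isUnit_iff.1 hu with rfl | rfl
  · omega
  · omega

theorem isIntegral_of_aeval_shanksPoly {n : ℤ} {ρ : ℂ} (hρ : aeval ρ (shanksPoly n) = 0) :
    IsIntegral ℤ ρ := ⟨shanksPoly n, shanksPoly_monic n, hρ⟩

theorem minpoly_eq_shanksPoly {n : ℤ} {ρ : ℂ} (hρ : aeval ρ (shanksPoly n) = 0) :
    minpoly ℚ ρ = (shanksPoly n).map (algebraMap ℤ ℚ) := by
  refine (minpoly.eq_of_irreducible_of_monic ?_ ?_ ((shanksPoly_monic n).map _)).symm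
  · exact ((shanksPoly_monic n).irreducible_iff_irreducible_map_fraction_map).1
      (shanksPoly_irreducible n)
  · rw [aeval_map_algebraMap, hρ]

theorem finrank_adjoin_root {n : ℤ} {ρ : ℂ} (hρ : aeval ρ (shanksPoly n) = 0) :
    Module.finrank ℚ ℚ⟮ρ⟯ = 3 := by
  rw [IntermediateField.adjoin.finrank (isIntegral_of_aeval_shanksPoly hρ).tower_top,
    minpoly_eq_shanksPoly hρ, (shanksPoly_monic n).natDegree_map, shanksPoly_natDegree]

theorem rootGen_cubic {n : ℤ} {ρ : ℂ} (hρ : aeval ρ (shanksPoly n) = 0) :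
    rootGen ρ ^ 3 - n * rootGen ρ ^ 2 - (n + 3) * rootGen ρ - 1 = 0 := by
  apply Subtype.ext
  rw [aeval_shanksPoly] at hρ
  exact hρ

/-- Excludes σ = 1, since three equal conjugates would sum to 3ρ = n. The contradiction is 27
f_n(n/3) = -(2n + 3)(n² + 3n + 9) ≠ 0. -/
theorem three_mul_rootGen_ne {n : ℤ} {ρ : ℂ} (hρ : aeval ρ (shanksPoly n) = 0) :
    3 * rootGen ρ - n ≠ 0 := by
  intro h
  have h0 := rootGen_cubic hρ
  have h1 : ((2 * n + 3 : ℤ) * (n ^ 2 + 3 * n + 9 : ℤ) : ℚ⟮ρ⟯) = 0 := by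
    push_cast
    grind
  rcases mul_eq_zero.1 h1 with h | h
  · have : 2 * n + 3 = 0 := by exact_mod_cast h
    omega
  · have : n ^ 2 + 3 * n + 9 = 0 := by exact_mod_cast h
    nlinarith [sq_nonneg (2 * n + 3)]

/-- The automorphism of the simplest cubic field, with the group it generates. -/
theorem exists_generator {n : ℤ} {ρ : ℂ} (hρ : aeval ρ (shanksPoly n) = 0) :
    FiniteDimensional ℚ ℚ⟮ρ⟯ ∧ IsGalois ℚ ℚ⟮ρ⟯ ∧ ∃ σ : ℚ⟮ρ⟯ ≃ₐ[ℚ] ℚ⟮ρ⟯,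
      σ (rootGen ρ) = rootGen ρ ^ 2 - (n + 1) * rootGen ρ - 2 ∧
      σ ≠ 1 ∧ σ * σ ≠ 1 ∧ (∀ x, σ (σ (σ x)) = x) ∧
      (∀ τ : ℚ⟮ρ⟯ ≃ₐ[ℚ] ℚ⟮ρ⟯, τ = 1 ∨ τ = σ ∨ τ = σ * σ) := by
  have hint : IsIntegral ℚ ρ := (isIntegral_of_aeval_shanksPoly hρ).tower_top
  have hfd : FiniteDimensional ℚ ℚ⟮ρ⟯ := IntermediateField.adjoin.finiteDimensional hint
  have hr := rootGen_cubic hρ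
  set r := rootGen ρ with hrdef
  have hroot : aeval (r ^ 2 - (n + 1) * r - 2) (minpoly ℚ ρ) = 0 := by
    rw [minpoly_eq_shanksPoly hρ, aeval_map_algebraMap, aeval_shanksPoly]
    exact shanks_conj_root hr
  let φ : ℚ⟮ρ⟯ →ₐ[ℚ] ℚ⟮ρ⟯ := (IntermediateField.algHomAdjoinIntegralEquiv ℚ hint).symm
    ⟨r ^ 2 - (n + 1) * r - 2, by
      rw [mem_aroots]
      exact ⟨minpoly.ne_zero hint, hroot⟩⟩
  let σ : ℚ⟮ρ⟯ ≃ₐ[ℚ] ℚ⟮ρ⟯ := AlgEquiv.ofBijective φ φ.bijective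
  have hσr : σ r = r ^ 2 - (n + 1) * r - 2 :=
    IntermediateField.algHomAdjoinIntegralEquiv_symm_apply_gen ℚ hint _
  have hext {τ τ' : ℚ⟮ρ⟯ ≃ₐ[ℚ] ℚ⟮ρ⟯} (h : τ r = τ' r) : τ = τ' := by
    have : (τ : ℚ⟮ρ⟯ →ₐ[ℚ] ℚ⟮ρ⟯) = τ' :=
      IntermediateField.adjoin_algHom_ext ℚ fun x hx => by
        obtain rfl := Set.mem_singleton_iff.1 hx
        exact h
    exact AlgEquiv.ext fun x => DFunLike.congr_fun this x
  have hσσr : σ (σ r) = n - r - (r ^ 2 - (n + 1) * r - 2) := by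
    rw [← shanks_conj_conj hr, hσr]
    simp only [map_sub, map_mul, map_add, map_pow, hσr, map_intCast, map_one]
    congr 1
    exact map_ofNat σ 2
  have hσσσr : σ (σ (σ r)) = r := by
    rw [hσσr]
    simp only [← hσr, map_sub, map_intCast, hσσr]
    ring
  have hσ3 (x) : σ (σ (σ x)) = x := by
    have : σ * (σ * σ) = 1 := hext hσσσr
    exact DFunLike.congr_fun this x
  have hσ1 : σ ≠ 1 := by
    intro h
    have h1 : σ r = r := DFunLike.congr_fun h r
    have h2 := hσσr
    rw [← hσr, h1, h1] at h2
    exact three_mul_rootGen_ne hρ (by linear_combination h2)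
  have hσσ1 : σ * σ ≠ 1 := by
    intro h
    have h3 : σ * (σ * σ) = 1 := hext hσσσr
    rw [h, mul_one] at h3
    exact hσ1 h3
  have hall (τ : ℚ⟮ρ⟯ ≃ₐ[ℚ] ℚ⟮ρ⟯) : τ = 1 ∨ τ = σ ∨ τ = σ * σ := by
    have hτ : aeval (τ r) (shanksPoly n) = 0 := by
      have h0 : aeval r (shanksPoly n) = 0 := by rw [aeval_shanksPoly]; exact hr
      have := congrArg τ h0
      rw [aeval_shanksPoly] at this ⊢
      have h3 : τ 3 = 3 := map_ofNat τ 3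
      simpa [h3] using this
    rw [aeval_shanksPoly, shanks_factor hr, ← hσr] at hτ
    rcases mul_eq_zero.1 hτ with h | h
    · rcases mul_eq_zero.1 h with h | h
      · exact .inl (hext (sub_eq_zero.1 h))
      · exact .inr (.inl (hext (sub_eq_zero.1 h)))
    · rw [hσr, ← hσσr] at h
      exact .inr (.inr (hext (sub_eq_zero.1 h)))
  refine ⟨hfd, ?_, σ, hσr, hσ1, hσσ1, hσ3, hall⟩
  apply IsGalois.of_card_aut_eq_finrank
  classical
  have hu : (Finset.univ : Finset (ℚ⟮ρ⟯ ≃ₐ[ℚ] ℚ⟮ρ⟯)) = {1, σ, σ * σ} := by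
    ext τ
    simpa using hall τ
  have hne : σ ≠ σ * σ := fun h => hσ1 (mul_eq_left.1 h.symm)
  rw [finrank_adjoin_root hρ, Nat.card_eq_fintype_card, ← Finset.card_univ, hu]
  exact Finset.card_eq_three.2 ⟨1, σ, σ * σ, hσ1.symm, hσσ1.symm, hne, rfl⟩

/-! ### Resolvent identities -/

theorem resolvent_sum {A : Type*} [CommRing A] {n r r₁ r₂ : A} (h₂ : r₂ = n - r - r₁) (a₀ a₁ : A) :
    (a₀ * (3 * r - n) + a₁ * (3 * r₁ - n)) + (a₀ * (3 * r₁ - n) + a₁ * (3 * r₂ - n)) +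
      (a₀ * (3 * r₂ - n) + a₁ * (3 * r - n)) = 0 := by
  rw [h₂]
  ring

theorem resolvent_pairs {A : Type*} [CommRing A] {n r r₁ r₂ : A}
    (h : r ^ 3 - n * r ^ 2 - (n + 3) * r - 1 = 0) (h₁ : r₁ = r ^ 2 - (n + 1) * r - 2)
    (h₂ : r₂ = n - r - r₁) (a₀ a₁ : A) :
    (a₀ * (3 * r - n) + a₁ * (3 * r₁ - n)) * (a₀ * (3 * r₁ - n) + a₁ * (3 * r₂ - n)) +
      (a₀ * (3 * r₁ - n) + a₁ * (3 * r₂ - n)) * (a₀ * (3 * r₂ - n) + a₁ * (3 * r - n)) +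
      (a₀ * (3 * r₂ - n) + a₁ * (3 * r - n)) * (a₀ * (3 * r - n) + a₁ * (3 * r₁ - n)) =
      -3 * (a₀ ^ 2 - a₀ * a₁ + a₁ ^ 2) * (n ^ 2 + 3 * n + 9) := by
  grind

/-- Cardano's shape Y³ = 3pY + q: the last factor of the constant term is the trace of A ā³, that is
e²c³ Tr(b). -/
theorem resolvent_cube {A : Type*} [CommRing A] {n r r₁ : A}
    (h : r ^ 3 - n * r ^ 2 - (n + 3) * r - 1 = 0) (h₁ : r₁ = r ^ 2 - (n + 1) * r - 2)
    (a₀ a₁ : A) :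
    (a₀ * (3 * r - n) + a₁ * (3 * r₁ - n)) ^ 3 =
      3 * (a₀ ^ 2 - a₀ * a₁ + a₁ ^ 2) * (n ^ 2 + 3 * n + 9) *
        (a₀ * (3 * r - n) + a₁ * (3 * r₁ - n)) +
      (n ^ 2 + 3 * n + 9) * ((2 * n + 3) * (a₀ ^ 3 - 3 * a₀ ^ 2 * a₁ + a₁ ^ 3) -
        (3 * n + 18) * (a₀ * a₁ * (a₁ - a₀))) := by
  grind

/-- Multiplicativity of the norm: N(A ā³) = (n² + 3n + 9)(ec)³. -/
theorem norm_resolvent {n d e c a₀ a₁ b₀ b₁ : ℤ} (he : e ≠ 0) (hc : c ≠ 0)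
    (hΔ : n ^ 2 + 3 * n + 9 = d * e ^ 2 * c ^ 3) (hec : e * c = a₀ ^ 2 - a₀ * a₁ + a₁ ^ 2)
    (h₀ : e ^ 2 * c ^ 3 * b₀ =
      (n + 3) * (a₀ ^ 3 - 3 * a₀ ^ 2 * a₁ + a₁ ^ 3) - 3 * 3 * (a₀ * a₁ * (a₁ - a₀)))
    (h₁ : e ^ 2 * c ^ 3 * b₁ =
      3 * (a₀ ^ 3 - 3 * a₀ ^ 2 * a₁ + a₁ ^ 3) + 3 * (n + 3 - 3) * (a₀ * a₁ * (a₁ - a₀))) :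
    b₀ ^ 2 - b₀ * b₁ + b₁ ^ 2 = d * e := by
  have hne : (e ^ 2 * c ^ 3) ^ 2 ≠ 0 := by positivity
  apply mul_left_cancel₀ hne
  calc (e ^ 2 * c ^ 3) ^ 2 * (b₀ ^ 2 - b₀ * b₁ + b₁ ^ 2)
      = (e ^ 2 * c ^ 3 * b₀) ^ 2 - (e ^ 2 * c ^ 3 * b₀) * (e ^ 2 * c ^ 3 * b₁) +
          (e ^ 2 * c ^ 3 * b₁) ^ 2 := by ring
    _ = (n ^ 2 + 3 * n + 9) * (a₀ ^ 2 - a₀ * a₁ + a₁ ^ 2) ^ 3 := by rw [h₀, h₁]; ring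
    _ = (e ^ 2 * c ^ 3) ^ 2 * (d * e) := by rw [hΔ, ← hec]; ring

theorem congruences_of_modEq_sign {ε b₀ b₁ f : ℤ} (hε : ε = 1 ∨ ε = -1)
    (hN : b₀ ^ 2 - b₀ * b₁ + b₁ ^ 2 = f) (h₀ : (3 : ℤ) ∣ b₀ - ε) (h₁ : (3 : ℤ) ∣ b₁) :
    f % 3 = 1 ∧ (27 : ℤ) ∣ ε + f * (2 * b₀ - b₁) - 3 * ε * f := by
  obtain ⟨p, hp⟩ := h₀
  obtain ⟨q, rfl⟩ := h₁
  obtain rfl : b₀ = ε + 3 * p := by linarith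
  have hε2 : ε ^ 2 = 1 := by rcases hε with rfl | rfl <;> norm_num
  constructor
  · have : f = 1 + 3 * (ε * (2 * p - q) + 3 * (p ^ 2 - p * q + q ^ 2)) := by
      linear_combination -hN + hε2
    omega
  -- Put β = p + qζ, s = Tr β, ν = N β. The expression is 9ε(s² - ν) + 27sν, and s² - ν = 3(p² -
  -- pq).
  · refine ⟨ε * (p ^ 2 - p * q) + (p ^ 2 - p * q + q ^ 2) * (2 * p - q), ?_⟩
    subst hN
    rcases hε with rfl | rfl <;> ring

/-! ### The normal integral basis -/

theorem theorem1 (n : ℤ) (hn : ¬ (3 : ℤ) ∣ n ∨ n ≡ 12 [ZMOD 27])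
    (ρ : ℂ) (hρ : Polynomial.aeval ρ (shanksPoly n) = 0)
    (d e c : ℤ) (hd : 0 < d) (he : 0 < e) (hc : 0 < c)
    (hdsq : Squarefree d) (hesq : Squarefree e) (hde : IsCoprime d e)
    (hΔ : n ^ 2 + 3 * n + 9 = d * e ^ 2 * c ^ 3)
    (a₀ a₁ : ℤ) (hec : e * c = a₀ ^ 2 - a₀ * a₁ + a₁ ^ 2)
    (hdvd : (a₀ : EisensteinRing) + (a₁ : EisensteinRing) * zetaE ∣
      (n : EisensteinRing) + 3 * (1 + zetaE)) :
    ∃ σ : ℚ⟮ρ⟯ ≃ₐ[ℚ] ℚ⟮ρ⟯,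
      Subgroup.zpowers σ = ⊤ ∧ σ (rootGen ρ) = -1 / (1 + rootGen ρ) ∧
      ∃ ε : ℤ, (ε = 1 ∨ ε = -1) ∧
        (¬ (3 : ℤ) ∣ n → ε ≡ n * (a₀ + a₁) [ZMOD 3]) ∧
        (n ≡ 12 [ZMOD 27] → ε ≡ a₀ [ZMOD 3]) ∧
        ∃ m : ℤ, 3 * m = ε * e * c ^ 2 - n * (a₀ + a₁) ∧
          1 / ((e : ℚ⟮ρ⟯) * (c : ℚ⟮ρ⟯) ^ 2) *
              ((a₀ : ℚ⟮ρ⟯) * rootGen ρ + (a₁ : ℚ⟮ρ⟯) * σ (rootGen ρ) + (m : ℚ⟮ρ⟯)) =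
            1 / ((e : ℚ⟮ρ⟯) * (c : ℚ⟮ρ⟯) ^ 2) *
              ((a₁ : ℚ⟮ρ⟯) * rootGen ρ ^ 2 +
                ((a₀ : ℚ⟮ρ⟯) - (a₁ : ℚ⟮ρ⟯) * (n : ℚ⟮ρ⟯) - (a₁ : ℚ⟮ρ⟯)) * rootGen ρ +
                (m : ℚ⟮ρ⟯) - 2 * (a₁ : ℚ⟮ρ⟯)) ∧
          IsNormalIntegralBasisGenerator ℚ⟮ρ⟯
            (1 / ((e : ℚ⟮ρ⟯) * (c : ℚ⟮ρ⟯) ^ 2) *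
              ((a₀ : ℚ⟮ρ⟯) * rootGen ρ + (a₁ : ℚ⟮ρ⟯) * σ (rootGen ρ) + (m : ℚ⟮ρ⟯))) := by
  obtain ⟨hfd, hgal, σ, hσr, hσ1, hσσ1, hσ3, hall⟩ := exists_generator hρ
  have hr := rootGen_cubic hρ
  set r := rootGen ρ with hrdef
  have hprod : σ r * (1 + r) = -1 := by
    rw [hσr]
    linear_combination hr
  have hr0 : 1 + r ≠ 0 := by
    intro h
    rw [h, mul_zero] at hprod
    exact absurd hprod (by norm_num)
  have hσσr : σ (σ r) = n - r - σ r := by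
    rw [hσr, ← shanks_conj_conj hr, ← hσr]
    have h2 : σ 2 = 2 := map_ofNat σ 2
    conv_lhs => rw [hσr]
    simp [h2]
  refine ⟨σ, ?_, by rw [eq_div_iff hr0, hprod], ?_⟩
  · rw [Subgroup.eq_top_iff']
    intro τ
    have hσmem := Subgroup.mem_zpowers σ
    rcases hall τ with rfl | rfl | rfl
    · exact one_mem _
    · exact hσmem
    · exact mul_mem hσmem hσmem
  obtain ⟨ε, b₀, b₁, hε, hε1, hε2, ⟨m, hm⟩, h₀, h₁, hb₀, hb₁⟩ : ∃ ε b₀ b₁ : ℤ,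
      (ε = 1 ∨ ε = -1) ∧ (¬ (3 : ℤ) ∣ n → ε ≡ n * (a₀ + a₁) [ZMOD 3]) ∧
      (n ≡ 12 [ZMOD 27] → ε ≡ a₀ [ZMOD 3]) ∧
      (3 : ℤ) ∣ ε * e * c ^ 2 - n * (a₀ + a₁) ∧
      e ^ 2 * c ^ 3 * b₀ =
        (n + 3) * (a₀ ^ 3 - 3 * a₀ ^ 2 * a₁ + a₁ ^ 3) - 3 * 3 * (a₀ * a₁ * (a₁ - a₀)) ∧
      e ^ 2 * c ^ 3 * b₁ =
        3 * (a₀ ^ 3 - 3 * a₀ ^ 2 * a₁ + a₁ ^ 3) + 3 * (n + 3 - 3) * (a₀ * a₁ * (a₁ - a₀)) ∧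
      (3 : ℤ) ∣ b₀ - ε ∧ (3 : ℤ) ∣ b₁ := by
    by_cases h3 : (3 : ℤ) ∣ n
    · have hn' := hn.resolve_left (not_not.2 h3)
      obtain ⟨ε, b₀, b₁, h1, h2, h⟩ :=
        exists_resolvent_data_of_modEq hn' he hc hdsq hesq hde hΔ hec hdvd
      exact ⟨ε, b₀, b₁, h1, fun h => absurd h3 h, fun _ => h2, h⟩
    · obtain ⟨ε, b₀, b₁, h1, h2, h⟩ := exists_resolvent_data_of_not_dvd h3 he hc hΔ hec hdvd
      refine ⟨ε, b₀, b₁, h1, fun _ => h2, fun h12 => absurd ?_ h3, h⟩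
      have : n % 27 = 12 := h12
      omega
  refine ⟨ε, hε, hε1, hε2, m, hm.symm, by rw [hσr]; ring, ?_⟩
  have hN := norm_resolvent he.ne' hc.ne' hΔ hec h₀ h₁
  obtain ⟨hf3, h27⟩ := congruences_of_modEq_sign hε hN hb₀ hb₁
  have hf : Squarefree (d * e) := squarefree_mul_iff.2 ⟨hde.isRelPrime, hdsq, hesq⟩
  have hE : (e * c ^ 2 : ℚ⟮ρ⟯) ≠ 0 := by
    have : e * c ^ 2 ≠ 0 := by positivity
    exact_mod_cast this
  have hmK : (3 * m : ℚ⟮ρ⟯) = ε * e * c ^ 2 - n * (a₀ + a₁) := by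
    exact_mod_cast congrArg (Int.cast) hm.symm
  have hΔK : (n ^ 2 + 3 * n + 9 : ℚ⟮ρ⟯) = d * e ^ 2 * c ^ 3 := by
    exact_mod_cast congrArg (Int.cast) hΔ
  have hecK : (a₀ ^ 2 - a₀ * a₁ + a₁ ^ 2 : ℚ⟮ρ⟯) = e * c := by
    exact_mod_cast congrArg (Int.cast) hec.symm
  have hTK : ((2 * n + 3) * (a₀ ^ 3 - 3 * a₀ ^ 2 * a₁ + a₁ ^ 3) -
      (3 * n + 18) * (a₀ * a₁ * (a₁ - a₀)) : ℚ⟮ρ⟯) = e ^ 2 * c ^ 3 * (2 * b₀ - b₁) := by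
    have : (2 * n + 3) * (a₀ ^ 3 - 3 * a₀ ^ 2 * a₁ + a₁ ^ 3) -
        (3 * n + 18) * (a₀ * a₁ * (a₁ - a₀)) = e ^ 2 * c ^ 3 * (2 * b₀ - b₁) := by
      linear_combination -2 * h₀ + h₁
    exact_mod_cast congrArg (Int.cast) this
  have hσ3c : σ 3 = 3 := map_ofNat σ 3
  -- This is 3α - ε: the definition of m cancels the trace.
  set y : ℚ⟮ρ⟯ := (a₀ * (3 * r - n) + a₁ * (3 * σ r - n)) / (e * c ^ 2) with hy
  have hy₁ : σ y = (a₀ * (3 * σ r - n) + a₁ * (3 * σ (σ r) - n)) / (e * c ^ 2) := by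
    simp [hy, hσ3c]
  have hy₂ : σ (σ y) = (a₀ * (3 * σ (σ r) - n) + a₁ * (3 * r - n)) / (e * c ^ 2) := by
    simp [hy₁, hσ3c, hσ3]
  refine isNormalIntegralBasisGenerator_of_cubic (f := d * e) (T := 2 * b₀ - b₁) (ε := ε) (y := y)
    hσ1 hσσ1 hσ3 hall hf hf3 (by rcases hε with rfl | rfl <;> norm_num) h27 ?_ ?_ ?_ ?_
  · rw [hy, one_div_mul_eq_div, ← mul_div_assoc, div_add' _ _ _ hE]
    congr 1
    linear_combination hmK
  · rw [hy₂, hy₁, hy, ← add_div, ← add_div, resolvent_sum hσσr, zero_div]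
  · rw [hy₂, hy₁, hy]
    have h := resolvent_pairs hr hσr hσσr (a₀ : ℚ⟮ρ⟯) a₁
    rw [hecK, hΔK] at h
    push_cast
    rw [div_mul_div_comm, div_mul_div_comm, div_mul_div_comm, ← add_div, ← add_div, h,
      div_eq_iff (mul_ne_zero hE hE)]
    ring
  · have h := resolvent_cube hr hσr (a₀ : ℚ⟮ρ⟯) a₁
    rw [hecK, hΔK, hTK] at h
    have hG : (a₀ * (3 * r - n) + a₁ * (3 * σ r - n) : ℚ⟮ρ⟯) = e * c ^ 2 * y :=
      (div_mul_cancel₀ _ hE).symm.trans (mul_comm _ _)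
    rw [hG] at h
    apply mul_left_cancel₀ (pow_ne_zero 3 hE)
    push_cast
    linear_combination h
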